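/- Let $\chi$ be a primitive real Dirichlet character modulo $q$ (its values lie in $\{-1,0,1\}$), let $L(s,\chi)$ be its $L$-function, and let $\beta_0$ be an exceptional zero of $L(s,\chi)$, that is, a real number with $L(\beta_0,\chi)=0$ and $\beta_0\ge 1-\dfrac{1}{R_0\log\max\{q,10\}}$, where $R_0=9.6459$. Let $\sigma\in(\beta_0,1)$. 1. If $\chi$ is odd, $q>4\cdot 10^5$ and $\beta_0\ge 1-\dfrac{800}{\sqrt q\,\log^2 q}$, then $|L'(\sigma,\chi)|\le 0.18\,\log^2 q$. 2. If $\chi$ is even, $q>4\cdot 10^5$ and $\beta_0\ge 1-\dfrac{515}{\sqrt q\,\log^2 q}$, then $|L'(\sigma,\chi)|\le 0.1536\,\log^2 q$. 3. If $\chi$ is even, $q>10^7$ and $\beta_0\ge 1-\dfrac{80}{\sqrt q\,\log^2 q}$, then $|L'(\sigma,\chi)|\le 0.15\,\log^2 q$. -/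

import Mathlib

/-- The real number `β` is an exceptional zero of `L(s, χ)`, where `χ` is a Dirichlet character
modulo `q`: it is a zero in the zero-free-up-to-one-zero region
`Re s ≥ 1 - 1 / (R₀ log max {q, q|Im s|, 10})`, `R₀ = 9.6459`, written here at the real point
`s = β`, where `Im s = 0`. -/
def IsExceptionalZero {q : ℕ} [NeZero q] (χ : DirichletCharacter ℂ q) (β : ℝ) : Prop :=
  1 - (9.6459 * Real.log (max (q : ℝ) 10))⁻¹ ≤ β ∧
    DirichletCharacter.LFunction χ (β : ℂ) = 0

/-! Weight `χ n` by a tent on `[0, y]` and let `S(y)` be the resulting sum (`tentSum`). Trivially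
`|S(y)| ≤ y² / 4`. A tent is essentially a convolution of two intervals of length `y / 2`, so
Fourier expansion, Parseval and Cauchy–Schwarz give `|S(y)| ≤ √q y / 2` with no logarithm
(`norm_tentSum_le`).

The Mellin transform of `S` is `(1 - 2⁻ˢ) L(s, χ) / (s (s + 1))`, first for `Re s > 1` and then for
`Re s > 0` by continuation (`mul_mellin_tentSum`). Differentiating at `σ` writes `L'(σ)` as a
multiple of `L(σ)` plus an integral of `S(y) y^(-σ-2)` against `log (y / Y)`, with `Y` free
(`deriv_LFunction_eq`). Using the trivial bound below `Y = √q / 2` and the other bound above it, the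
integral term is at most `Y^(1-σ) (log² Y / 2 + 4 / σ²)`, where `log² Y / 2` is about `log² q / 8`.

The term in `L(σ)` is absorbed: `L` vanishes at `β`, so on `[β, 1]` it is at most `(1 - β) max
|L'|`, and `(1 - β) log Y` is small for an exceptional zero (`norm_deriv_LFunction_mul_le_of_zero`).
The losses raise the leading constant `1/8` to at most `0.15` once `q > 4 · 10⁵`, and this one bound
gives all three claims. -/

/-! ### Finite Fourier analysis and a smoothed Pólya–Vinogradov inequality -/

open scoped ZMod in
lemma ZMod.sum_norm_sq_dft {q : ℕ} [NeZero q] (Φ : ZMod q → ℂ) :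
    ∑ k, ‖𝓕 Φ k‖ ^ 2 = q * ∑ j, ‖Φ j‖ ^ 2 := by
  have key : ∑ k, (starRingEnd ℂ) (𝓕 Φ k) * 𝓕 Φ k = q * ∑ j, (starRingEnd ℂ) (Φ j) * Φ j := by
    have h (k : ZMod q) : (starRingEnd ℂ) (𝓕 Φ k) =
        ∑ j, (starRingEnd ℂ) (Φ j) * ZMod.stdAddChar (j * k) := by
      simp only [ZMod.dft_apply, map_sum, smul_eq_mul, map_mul]
      refine Finset.sum_congr rfl fun j _ ↦ ?_
      rw [mul_comm, AddChar.map_neg_eq_conj, Complex.conj_conj]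
    simp_rw [h, Finset.sum_mul]
    rw [Finset.sum_comm, Finset.mul_sum]
    refine Finset.sum_congr rfl fun j _ ↦ ?_
    have h2 : ∑ k, ZMod.stdAddChar (k * j) * 𝓕 Φ k = q * Φ j := by
      have := congrFun (ZMod.dft_dft Φ) (-j)
      simpa [ZMod.dft_apply (𝓕 Φ)] using this
    rw [mul_left_comm, ← h2, Finset.mul_sum]
    refine Finset.sum_congr rfl fun k _ ↦ ?_
    rw [mul_comm j k]; ring
  simp_rw [Complex.conj_mul'] at key
  exact_mod_cast key

lemma Complex.norm_sum_mul_mul_le {ι : Type*} (s : Finset ι) (f g h : ι → ℂ) {C : ℝ}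
    (hC : 0 ≤ C) (hf : ∀ i ∈ s, ‖f i‖ ≤ C) :
    ‖∑ i ∈ s, f i * g i * h i‖ ≤
      C * (√(∑ i ∈ s, ‖g i‖ ^ 2) * √(∑ i ∈ s, ‖h i‖ ^ 2)) := by
  calc ‖∑ i ∈ s, f i * g i * h i‖ ≤ ∑ i ∈ s, C * (‖g i‖ * ‖h i‖) := by
        refine norm_sum_le_of_le _ fun i hi ↦ ?_
        rw [norm_mul, norm_mul, mul_assoc]
        gcongr
        exact hf i hi
    _ ≤ _ := by
        rw [← Finset.mul_sum]
        gcongr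
        exact Real.sum_mul_le_sqrt_mul_sqrt _ _ _

lemma ZMod.sum_image_natCast_range {q N : ℕ} (hN : N ≤ q) (f : ZMod q → ℂ) :
    ∑ x ∈ (Finset.range N).image (Nat.cast : ℕ → ZMod q), f x = ∑ i ∈ Finset.range N, f i := by
  refine Finset.sum_image fun i hi j hj hij ↦ ?_
  simp only [Finset.coe_range, Set.mem_Iio] at hi hj
  rwa [ZMod.natCast_eq_natCast_iff', Nat.mod_eq_of_lt (by omega), Nat.mod_eq_of_lt (by omega)]
    at hij

namespace DirichletCharacter

variable {q : ℕ} [NeZero q] {χ : DirichletCharacter ℂ q}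

-- The transform of a primitive character is `χ⁻¹(-k)` times the Gauss sum, so its modulus is that
-- of `χ(-k)` up to a constant factor. Parseval then forces the squared modulus of the Gauss sum to
-- be `q`.
open scoped ZMod in
lemma norm_dft_le_of_isPrimitive (hχ : χ.IsPrimitive) (k : ZMod q) : ‖𝓕 χ k‖ ≤ √q := by
  set g := gaussSum χ ZMod.stdAddChar with hg
  have h (k : ZMod q) : ‖𝓕 χ k‖ = ‖χ (-k)‖ * ‖g‖ := by
    rw [hχ.fourierTransform_eq_inv_mul_gaussSum, norm_mul, ← MulChar.star_apply', norm_star]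
  have h1 := ZMod.sum_norm_sq_dft (χ : ZMod q → ℂ)
  have h2 : ∑ j : ZMod q, ‖χ (-j)‖ ^ 2 = ∑ j : ZMod q, ‖χ j‖ ^ 2 :=
    Equiv.sum_comp (Equiv.neg (ZMod q)) fun j ↦ ‖χ j‖ ^ 2
  simp_rw [h, mul_pow, ← Finset.sum_mul, h2] at h1
  have h3 : 0 < ∑ j : ZMod q, ‖χ j‖ ^ 2 :=
    Finset.sum_pos' (fun _ _ ↦ by positivity) ⟨1, Finset.mem_univ _, by simp⟩
  have h4 : ‖g‖ ^ 2 = q := by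
    rw [mul_comm] at h1
    exact mul_right_cancel₀ h3.ne' h1
  rw [h, ← h4, Real.sqrt_sq (norm_nonneg _)]
  exact mul_le_of_le_one_left (norm_nonneg _) (χ.norm_le_one _)

open scoped ZMod in
/-- A bilinear form of the Pólya–Vinogradov inequality. -/
lemma norm_sum_sum_add_le_of_isPrimitive (hχ : χ.IsPrimitive) (I J : Finset (ZMod q)) :
    ‖∑ i ∈ I, ∑ j ∈ J, χ (i + j)‖ ≤ √q * (√I.card * √J.card) := by
  have hq : (0 : ℝ) < q := by exact_mod_cast NeZero.pos q
  let ind (I : Finset (ZMod q)) : ZMod q → ℂ := fun i ↦ if i ∈ I then 1 else 0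
  have hind (I : Finset (ZMod q)) (k : ZMod q) :
      𝓕 (ind I) (-k) = ∑ i ∈ I, ZMod.stdAddChar (i * k) := by
    simp [ZMod.dft_apply, ind]
  have hpars (I : Finset (ZMod q)) : ∑ k, ‖𝓕 (ind I) (-k)‖ ^ 2 = q * I.card := by
    refine (Equiv.sum_comp (Equiv.neg (ZMod q)) fun k ↦ ‖𝓕 (ind I) k‖ ^ 2).trans ?_
    rw [ZMod.sum_norm_sq_dft]
    simp [ind, apply_ite, ite_pow]
  have hinv (n : ZMod q) : (q : ℂ) * χ n = ∑ k, 𝓕 χ k * ZMod.stdAddChar (n * k) := by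
    have := congrFun (ZMod.dft_dft (χ : ZMod q → ℂ)) (-n)
    simp only [ZMod.dft_apply (𝓕 (χ : ZMod q → ℂ)), neg_neg, smul_eq_mul] at this
    rw [← this]
    refine Finset.sum_congr rfl fun k _ ↦ ?_
    rw [mul_comm, mul_neg, neg_neg, mul_comm n]
  -- Additive characters split over `i + j`, so each frequency contributes a product of the
  -- transforms of the two indicators. Cauchy–Schwarz and Parseval then handle these two factors.
  have key : (q : ℂ) * ∑ i ∈ I, ∑ j ∈ J, χ (i + j) =
      ∑ k, 𝓕 χ k * 𝓕 (ind I) (-k) * 𝓕 (ind J) (-k) := by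
    simp_rw [Finset.mul_sum, hinv, hind, mul_assoc, Finset.sum_mul_sum, Finset.mul_sum]
    rw [Finset.sum_congr rfl fun i _ ↦ Finset.sum_comm, Finset.sum_comm]
    refine Finset.sum_congr rfl fun k _ ↦ Finset.sum_congr rfl fun i _ ↦
      Finset.sum_congr rfl fun j _ ↦ ?_
    rw [add_mul, AddChar.map_add_eq_mul]
  have h := Complex.norm_sum_mul_mul_le Finset.univ (𝓕 χ) (fun k ↦ 𝓕 (ind I) (-k))
    (fun k ↦ 𝓕 (ind J) (-k)) (Real.sqrt_nonneg _) fun k _ ↦ norm_dft_le_of_isPrimitive hχ k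
  rw [← key, hpars, hpars, norm_mul, Complex.norm_natCast, Real.sqrt_mul hq.le,
    Real.sqrt_mul hq.le] at h
  refine le_of_mul_le_mul_left (h.trans_eq ?_) hq
  have := Real.mul_self_sqrt hq.le
  linear_combination √q * √I.card * √J.card * this

lemma sum_range_natCast_add_eq_zero (hχ : χ ≠ 1) (a : ZMod q) :
    ∑ i ∈ Finset.range q, χ (i + a) = 0 := by
  have h1 : ∑ x : ZMod q, χ (x + a) = 0 := by
    refine (Equiv.sum_comp (Equiv.addRight a) χ).trans ?_
    exact MulChar.sum_eq_zero_of_ne_one hχ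
  rw [← h1]
  refine Finset.sum_bij' (fun i _ ↦ (i : ZMod q)) (fun x _ ↦ x.val) ?_ ?_ ?_ ?_ ?_
  · simp
  · intro x _; simpa using ZMod.val_lt x
  · intro i hi; exact ZMod.val_cast_of_lt (Finset.mem_range.mp hi)
  · intro x _; simp
  · simp

lemma sum_range_natCast_add_mod (hχ : χ ≠ 1) (a : ZMod q) (N : ℕ) :
    ∑ i ∈ Finset.range N, χ (i + a) = ∑ i ∈ Finset.range (N % q), χ (i + a) := by
  induction N using Nat.strong_induction_on with
  | _ N ih =>
    rcases lt_or_ge N q with h | h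
    · rw [Nat.mod_eq_of_lt h]
    · obtain ⟨M, rfl⟩ := Nat.exists_eq_add_of_le h
      rw [Finset.sum_range_add, sum_range_natCast_add_eq_zero hχ, Nat.add_mod_left, ← ih M
        (by have := NeZero.pos q; omega)]
      simp

/-- A smoothed Pólya–Vinogradov inequality. -/
lemma norm_sum_range_sum_range_le (hχ : χ.IsPrimitive) (h1 : χ ≠ 1) (N M : ℕ) (a : ZMod q) :
    ‖∑ i ∈ Finset.range N, ∑ j ∈ Finset.range M, χ (i + j + a)‖ ≤ √q * (√N * √M) := by
  have hq := NeZero.pos q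
  have hN : N % q ≤ q := (Nat.mod_lt _ hq).le
  have hM : M % q ≤ q := (Nat.mod_lt _ hq).le
  -- Sums over full periods vanish, so both lengths reduce mod `q`; on the shortened ranges the cast
  -- to `ZMod q` is injective, and the bilinear bound for subsets applies.
  have e : ∑ i ∈ Finset.range N, ∑ j ∈ Finset.range M, χ (i + j + a) =
      ∑ i ∈ Finset.range (N % q), ∑ j ∈ Finset.range (M % q), χ (i + (j + a)) := by
    have e1 (i : ℕ) : ∑ j ∈ Finset.range M, χ (i + j + a) =
        ∑ j ∈ Finset.range (M % q), χ (j + (i + a)) := by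
      rw [← sum_range_natCast_add_mod h1]
      exact Finset.sum_congr rfl fun j _ ↦ by congr 1; ring
    simp_rw [e1]
    rw [Finset.sum_comm]
    have e2 (j : ℕ) : ∑ i ∈ Finset.range N, χ (j + (i + a)) =
        ∑ i ∈ Finset.range (N % q), χ (i + (j + a)) := by
      rw [← sum_range_natCast_add_mod h1]
      exact Finset.sum_congr rfl fun j _ ↦ by congr 1; ring
    simp_rw [e2]
    rw [Finset.sum_comm]
  have e3 : ∑ i ∈ Finset.range (N % q), ∑ j ∈ Finset.range (M % q), χ (i + (j + a)) =
      ∑ x ∈ (Finset.range (N % q)).image (Nat.cast : ℕ → ZMod q),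
        ∑ y ∈ ((Finset.range (M % q)).image (Nat.cast : ℕ → ZMod q)).map
          (addRightEmbedding a), χ (x + y) := by
    simp_rw [Finset.sum_map, addRightEmbedding_apply]
    rw [ZMod.sum_image_natCast_range hN fun x ↦ ∑ y ∈ (Finset.range (M % q)).image
      (Nat.cast : ℕ → ZMod q), χ (x + (y + a))]
    exact Finset.sum_congr rfl fun i _ ↦
      (ZMod.sum_image_natCast_range hM fun y ↦ χ (i + (y + a))).symm
  have hcard (N : ℕ) : ((Finset.range (N % q)).image (Nat.cast : ℕ → ZMod q)).card ≤ N :=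
    Finset.card_image_le.trans (by simpa using Nat.mod_le N q)
  rw [e, e3]
  refine (norm_sum_sum_add_le_of_isPrimitive hχ _ _).trans ?_
  rw [Finset.card_map]
  gcongr
  · exact hcard N
  · exact hcard M

end DirichletCharacter

/-! ### Tent weights -/

/-- The difference of ramps `(y - n)⁺ - (y - 2n)⁺`; as a function of `n` it is a tent supported
on `[0, y]` with apex at `y / 2`. -/
noncomputable def tent (y : ℝ) (n : ℕ) : ℝ := max (y - n) 0 - max (y - 2 * n) 0

lemma tent_nonneg (y : ℝ) (n : ℕ) : 0 ≤ tent y n := by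
  have : (0 : ℝ) ≤ n := n.cast_nonneg
  exact sub_nonneg.mpr (max_le_max_right _ (by linarith))

lemma tent_eq_zero {y : ℝ} {n : ℕ} (h : y ≤ n) : tent y n = 0 := by
  have : (0 : ℝ) ≤ n := n.cast_nonneg
  rw [tent, max_eq_right (by linarith), max_eq_right (by linarith), sub_zero]

/-- Summation by parts: for `n < M`, the ramp `M - n` counts the `m` with `n ≤ m < M`. -/
lemma sum_range_max_sub_mul (a : ℕ → ℂ) {M K : ℕ} (h : M ≤ K) :
    ∑ n ∈ Finset.range K, ((max ((M : ℝ) - n) 0 : ℝ) : ℂ) * a n =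
      ∑ m ∈ Finset.range M, ∑ n ∈ Finset.range (m + 1), a n := by
  induction M with
  | zero =>
    refine Finset.sum_eq_zero fun n _ ↦ ?_
    have : (0 : ℝ) ≤ n := n.cast_nonneg
    rw [max_eq_right (by simp)]
    simp
  | succ M ih =>
    rw [Finset.sum_range_succ, ← ih (by omega), ← Finset.sum_range_add_sum_Ico _ h,
      ← Finset.sum_range_add_sum_Ico (fun n ↦ ((max ((M : ℝ) - n) 0 : ℝ) : ℂ) * a n) h,
      add_right_comm, ← Finset.sum_add_distrib]
    congr 1
    · refine Finset.sum_congr rfl fun n hn ↦ ?_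
      have : (n : ℝ) ≤ M := by exact_mod_cast Nat.lt_succ_iff.mp (Finset.mem_range.mp hn)
      push_cast
      rw [max_eq_left (by linarith), max_eq_left (by linarith)]
      push_cast
      ring
    · refine Finset.sum_congr rfl fun n hn ↦ ?_
      have : ((M + 1 : ℕ) : ℝ) ≤ n := by exact_mod_cast (Finset.mem_Ico.mp hn).1
      have h2 : (M : ℝ) ≤ n := le_trans (by simp) this
      rw [max_eq_right (by linarith), max_eq_right (by linarith)]

/-- At an integer `N + M` the tent is the convolution of the indicators of two intervals of nearly
equal lengths `N` and `M`. Allowing `M = N + 1` covers odd integers: at integer points the ramp `(N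
+ M - 2n)⁺` is still `(N - n)⁺ + (M - n)⁺`. -/
lemma sum_tent_natCast (a : ℕ → ℂ) {N M : ℕ} (h1 : N ≤ M) (h2 : M ≤ N + 1) :
    ∑ n ∈ Finset.range (N + M + 1), a n * (tent (N + M : ℕ) n : ℝ) =
      ∑ i ∈ Finset.range N, ∑ j ∈ Finset.range M, a (i + j + 1) := by
  have hsplit (n : ℕ) : a n * (tent (N + M : ℕ) n : ℝ) =
      ((max (((N + M : ℕ) : ℝ) - n) 0 : ℝ) : ℂ) * a n - ((max ((N : ℝ) - n) 0 : ℝ) : ℂ) * a n -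
        ((max ((M : ℝ) - n) 0 : ℝ) : ℂ) * a n := by
    have : max (((N + M : ℕ) : ℝ) - 2 * n) 0 = max ((N : ℝ) - n) 0 + max ((M : ℝ) - n) 0 := by
      push_cast
      have a1 : (N : ℝ) ≤ M := by exact_mod_cast h1
      have a2 : (M : ℝ) ≤ N + 1 := by exact_mod_cast h2
      rcases le_or_gt n N with h | h
      · have : (n : ℝ) ≤ N := by exact_mod_cast h
        rw [max_eq_left (by linarith), max_eq_left (by linarith), max_eq_left (by linarith)]
        ring
      · have : (N : ℝ) + 1 ≤ n := by exact_mod_cast h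
        rw [max_eq_right (by linarith), max_eq_right (by linarith), max_eq_right (by linarith)]
        ring
    rw [tent, this]
    push_cast
    ring
  simp_rw [hsplit, Finset.sum_sub_distrib]
  rw [sum_range_max_sub_mul a (by omega), sum_range_max_sub_mul a (by omega),
    sum_range_max_sub_mul a (by omega), add_comm N M, Finset.sum_range_add, add_sub_right_comm,
    add_sub_right_comm, sub_sub_cancel_left]
  have h3 (i : ℕ) : ∑ j ∈ Finset.range M, a (i + j + 1) =
      ∑ n ∈ Finset.range (M + i + 1), a n - ∑ n ∈ Finset.range (i + 1), a n := by
    rw [add_comm M i, add_right_comm i M 1, Finset.sum_range_add, add_sub_cancel_left]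
    exact Finset.sum_congr rfl fun j _ ↦ by congr 1; ring
  simp_rw [h3, Finset.sum_sub_distrib]
  ring

/-- As a function of `y` the tent has kinks only at the integers `n` and `2n`, so it is affine on
`[k, k + 1]`. This carries bounds from integers to real `y`. -/
lemma tent_interpolate (k n : ℕ) {t : ℝ} (h0 : 0 ≤ t) (h1 : t ≤ 1) :
    tent (k + t) n = (1 - t) * tent k n + t * tent (k + 1 : ℕ) n := by
  have key (m : ℕ) : max (k + t - m) 0 =
      (1 - t) * max ((k : ℝ) - m) 0 + t * max (((k + 1 : ℕ) : ℝ) - m) 0 := by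
    push_cast
    rcases le_or_gt m k with h | h
    · have : (m : ℝ) ≤ k := by exact_mod_cast h
      rw [max_eq_left (by linarith), max_eq_left (by linarith), max_eq_left (by linarith)]
      ring
    · have : (k : ℝ) + 1 ≤ m := by exact_mod_cast h
      rw [max_eq_right (by linarith), max_eq_right (by linarith), max_eq_right (by linarith)]
      ring
  have k1 := key n
  have k2 := key (2 * n)
  rw [Nat.cast_mul, Nat.cast_ofNat] at k2
  rw [tent, tent, tent, k1, k2]
  ring

lemma sum_range_tent_le {y : ℝ} (hy : 0 ≤ y) :
    ∑ n ∈ Finset.range (⌊y⌋₊ + 1), tent y n ≤ y ^ 2 / 4 := by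
  have hgauss (K : ℕ) : ∑ n ∈ Finset.range (K + 1), (n : ℝ) = K * (K + 1) / 2 := by
    induction K with
    | zero => simp
    | succ K ih => rw [Finset.sum_range_succ, ih]; push_cast; ring
  set k := ⌊y⌋₊
  have hk : (k : ℝ) ≤ y := Nat.floor_le hy
  -- Keeping only `n ≤ m` in the subtracted ramp gives an upper bound for every `m`. With `m = ⌊k /
  -- 2⌋` the bound is `r y - r²` for `r = m` or `r = m + 1`, which is at most `y² / 4`.
  have hle (m : ℕ) (hm : m ≤ k) : ∑ n ∈ Finset.range (k + 1), tent y n ≤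
      ((k + 1) * y - k * (k + 1) / 2) - ((m + 1) * y - m * (m + 1)) := by
    simp only [tent, Finset.sum_sub_distrib]
    gcongr
    · refine le_of_eq ?_
      rw [← hgauss k]
      calc _ = ∑ n ∈ Finset.range (k + 1), (y - n) := by
            refine Finset.sum_congr rfl fun n hn ↦ max_eq_left ?_
            have : (n : ℝ) ≤ k := by exact_mod_cast Nat.lt_succ_iff.mp (Finset.mem_range.mp hn)
            linarith
        _ = _ := by simp [Finset.sum_sub_distrib]
    · calc ((m : ℝ) + 1) * y - m * (m + 1) = ∑ n ∈ Finset.range (m + 1), (y - 2 * n) := by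
            rw [Finset.sum_sub_distrib, ← Finset.mul_sum, hgauss]
            simp
            ring
        _ ≤ ∑ n ∈ Finset.range (m + 1), max (y - 2 * n) 0 :=
            Finset.sum_le_sum fun n _ ↦ le_max_left _ _
        _ ≤ _ := Finset.sum_le_sum_of_subset_of_nonneg
            (Finset.range_subset_range.mpr (by omega)) fun _ _ _ ↦ le_max_right _ _
  rcases Nat.even_or_odd' k with ⟨m, hm | hm⟩
  · refine (hle m (by omega)).trans ?_
    have : (k : ℝ) = 2 * m := by exact_mod_cast hm
    rw [this]
    nlinarith [sq_nonneg (y - 2 * m)]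
  · refine (hle m (by omega)).trans ?_
    have : (k : ℝ) = 2 * m + 1 := by exact_mod_cast hm
    rw [this]
    nlinarith [sq_nonneg (y - 2 * (m + 1))]

/-! ### Bounds for the smoothed character sum -/

namespace DirichletCharacter

variable {q : ℕ}

/-- The sum of the values of `χ` smoothed by a tent on `[0, y]`. -/
noncomputable def tentSum (χ : DirichletCharacter ℂ q) (y : ℝ) : ℂ :=
  ∑ n ∈ Finset.range (⌊y⌋₊ + 1), χ n * (tent y n : ℝ)

variable {χ : DirichletCharacter ℂ q}

lemma norm_tentSum_le_sq {y : ℝ} (hy : 0 ≤ y) : ‖tentSum χ y‖ ≤ y ^ 2 / 4 := by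
  refine le_trans (norm_sum_le_of_le _ fun n _ ↦ ?_) (sum_range_tent_le hy)
  rw [norm_mul, Complex.norm_real, Real.norm_of_nonneg (tent_nonneg y n)]
  exact mul_le_of_le_one_left (tent_nonneg y n) (χ.norm_le_one _)

lemma tentSum_eq_zero {y : ℝ} (hy : y ≤ 1) : tentSum χ y = 0 := by
  refine Finset.sum_eq_zero fun n _ ↦ ?_
  rcases Nat.eq_zero_or_pos n with rfl | hn
  · simp [tent]
  · rw [tent_eq_zero (hy.trans (by exact_mod_cast hn)), Complex.ofReal_zero, mul_zero]

lemma norm_tentSum_natCast_le [NeZero q] (hχ : χ.IsPrimitive) (h1 : χ ≠ 1) (k : ℕ) :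
    ‖tentSum χ k‖ ≤ √q * (k / 2) := by
  obtain ⟨N, M, rfl, hNM, hMN⟩ : ∃ N M, k = N + M ∧ N ≤ M ∧ M ≤ N + 1 :=
    ⟨k / 2, k - k / 2, by omega, by omega, by omega⟩
  have h := norm_sum_range_sum_range_le hχ h1 N M 1
  have e := sum_tent_natCast (fun n ↦ χ n) hNM hMN
  push_cast at e
  rw [tentSum, Nat.floor_natCast]
  push_cast
  rw [e]
  refine h.trans ?_
  gcongr
  -- This is AM–GM: `√N √M ≤ (N + M) / 2`.
  nlinarith [sq_nonneg (√N - √M), Real.sq_sqrt (Nat.cast_nonneg (α := ℝ) N),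
    Real.sq_sqrt (Nat.cast_nonneg (α := ℝ) M)]

lemma norm_tentSum_le [NeZero q] (hχ : χ.IsPrimitive) (h1 : χ ≠ 1) {y : ℝ} (hy : 0 ≤ y) :
    ‖tentSum χ y‖ ≤ √q * (y / 2) := by
  obtain ⟨t, ht⟩ : ∃ t, t = y - ⌊y⌋₊ := ⟨_, rfl⟩
  have ht0 : 0 ≤ t := by linarith [Nat.floor_le hy]
  have ht1 : t ≤ 1 := by linarith [Nat.lt_floor_add_one y]
  have e : tentSum χ y =
      ((1 - t : ℝ) : ℂ) * tentSum χ ⌊y⌋₊ + (t : ℂ) * tentSum χ (⌊y⌋₊ + 1 : ℕ) := by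
    simp only [tentSum, Nat.floor_natCast]
    rw [Finset.sum_range_succ _ (⌊y⌋₊ + 1), tent_eq_zero (n := ⌊y⌋₊ + 1) le_rfl,
      Complex.ofReal_zero, mul_zero, add_zero, Finset.mul_sum, Finset.mul_sum,
      ← Finset.sum_add_distrib]
    refine Finset.sum_congr rfl fun n _ ↦ ?_
    rw [show y = ⌊y⌋₊ + t by rw [ht]; ring]
    rw [show ⌊(⌊y⌋₊ : ℝ) + t⌋₊ = ⌊y⌋₊ by congr 1; rw [ht]; ring]
    rw [tent_interpolate _ _ ht0 ht1]
    push_cast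
    ring
  rw [e]
  refine (norm_add_le _ _).trans ?_
  rw [norm_mul, norm_mul, Complex.norm_of_nonneg (by linarith), Complex.norm_of_nonneg ht0]
  calc _ ≤ (1 - t) * (√q * (⌊y⌋₊ / 2)) + t * (√q * ((⌊y⌋₊ + 1 : ℕ) / 2)) := by
        gcongr
        · exact norm_tentSum_natCast_le hχ h1 _
        · exact norm_tentSum_natCast_le hχ h1 _
    _ = √q * ((⌊y⌋₊ + t) / 2) := by push_cast; ring
    _ = _ := by rw [ht]; ring

end DirichletCharacter

/-! ### Mellin transform of the smoothed sum -/

section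

open Complex MeasureTheory Set Filter Asymptotics Topology

lemma hasMellin_ramp {c : ℝ} (hc : 0 < c) {s : ℂ} (hs : 0 < s.re) :
    HasMellin (fun y : ℝ ↦ ((max (y - c) 0 : ℝ) : ℂ)) (-s - 1)
      ((c : ℂ) ^ (-s) / (s * (s + 1))) := by
  have hs0 : s ≠ 0 := fun h ↦ by simp [h] at hs
  have hs1 : s + 1 ≠ 0 := fun h ↦ by
    have := congrArg re h
    simp at this
    linarith
  have hc0 : (c : ℂ) ≠ 0 := by exact_mod_cast hc.ne'
  have e : EqOn (fun y : ℝ ↦ (y : ℂ) ^ (-s - 1 - 1) • ((max (y - c) 0 : ℝ) : ℂ))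
      ((Ioi c).indicator fun y : ℝ ↦ (y : ℂ) ^ (-s - 1) - c * (y : ℂ) ^ (-s - 2)) (Ioi 0) := by
    intro y (hy : 0 < y)
    rcases le_or_gt y c with h | h
    · rw [indicator_of_notMem (by simpa using h)]
      simp [max_eq_right (sub_nonpos.mpr h)]
    · have hy0 : (y : ℂ) ≠ 0 := by exact_mod_cast hy.ne'
      have hpow : (y : ℂ) ^ (-s - 1) = (y : ℂ) ^ (-s - 2) * y := by
        rw [show -s - 1 = -s - 2 + 1 by ring, cpow_add _ _ hy0, cpow_one]
      rw [indicator_of_mem (by simpa using h)]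
      simp only [smul_eq_mul, max_eq_left (sub_nonneg.mpr h.le)]
      rw [hpow, show -s - 1 - 1 = -s - 2 by ring]
      push_cast
      ring
  have i1 : IntegrableOn (fun y : ℝ ↦ (y : ℂ) ^ (-s - 1)) (Ioi c) :=
    integrableOn_Ioi_cpow_of_lt (by simp; linarith) hc
  have i2 : IntegrableOn (fun y : ℝ ↦ (c : ℂ) * (y : ℂ) ^ (-s - 2)) (Ioi c) :=
    (integrableOn_Ioi_cpow_of_lt (by simp; linarith) hc).const_mul _
  have hsub : Ioi c ∩ Ioi 0 = Ioi c := inter_eq_left.mpr (Ioi_subset_Ioi hc.le)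
  constructor
  · rw [MellinConvergent, integrableOn_congr_fun e measurableSet_Ioi, IntegrableOn,
      integrable_indicator_iff measurableSet_Ioi, IntegrableOn,
      Measure.restrict_restrict measurableSet_Ioi, hsub]
    exact i1.sub i2
  · rw [mellin, setIntegral_congr_fun measurableSet_Ioi e, integral_indicator measurableSet_Ioi,
      Measure.restrict_restrict measurableSet_Ioi, hsub, integral_sub i1 i2,
      integral_const_mul, integral_Ioi_cpow_of_lt (by simp; linarith) hc,
      integral_Ioi_cpow_of_lt (by simp; linarith) hc, show -s - 1 + 1 = -s by ring,
      show -s - 2 + 1 = -s - 1 by ring, cpow_sub _ _ hc0, cpow_one]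
    have hs2 : -s - 1 ≠ 0 := fun h ↦ hs1 (by linear_combination -h)
    field_simp
    ring

/-- The ramps start at `n` and `2n`, so their transforms differ by the factor `2⁻ˢ`; this is the
source of `1 - 2⁻ˢ`. -/
lemma hasMellin_tent {n : ℕ} (hn : n ≠ 0) {s : ℂ} (hs : 0 < s.re) :
    HasMellin (fun y : ℝ ↦ (tent y n : ℂ)) (-s - 1)
      ((1 - (2 : ℂ) ^ (-s)) / (s * (s + 1)) * (n : ℂ) ^ (-s)) := by
  have hn' : (0 : ℝ) < n := by exact_mod_cast Nat.pos_of_ne_zero hn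
  have h1 := hasMellin_ramp hn' hs
  have h2 := hasMellin_ramp (c := 2 * n) (by positivity) hs
  have h := hasMellin_sub h1.1 h2.1
  rw [h1.2, h2.2, ofReal_mul, mul_cpow_ofReal_nonneg zero_le_two hn'.le] at h
  convert h using 1
  · ext y
    simp [tent]
  · push_cast
    ring

namespace DirichletCharacter

variable {q : ℕ} (χ : DirichletCharacter ℂ q)

lemma hasSum_tentSum (y : ℝ) : HasSum (fun n : ℕ ↦ χ n * (tent y n : ℂ)) (tentSum χ y) := by
  refine hasSum_sum_of_ne_finset_zero fun n hn ↦ ?_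
  rw [tent_eq_zero, ofReal_zero, mul_zero]
  have : ⌊y⌋₊ + 1 ≤ n := by simpa using hn
  have : ((⌊y⌋₊ + 1 : ℕ) : ℝ) ≤ n := by exact_mod_cast this
  push_cast at this
  linarith [Nat.lt_floor_add_one y]

lemma measurable_tentSum : Measurable (tentSum χ) := by
  have ht (n : ℕ) : Measurable fun y ↦ (tent y n : ℂ) := by
    unfold tent
    fun_prop
  exact measurable_of_tendsto_metrizable
    (fun N ↦ Finset.measurable_fun_sum (Finset.range N) fun n _ ↦ (ht n).const_mul (χ n))
    (tendsto_pi_nhds.mpr fun y ↦ (χ.hasSum_tentSum y).tendsto_sum_nat)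

lemma locallyIntegrable_tentSum : LocallyIntegrable (tentSum χ) := by
  have hg : LocallyIntegrable fun y : ℝ ↦ y ^ 2 / 4 :=
    (by fun_prop : Continuous fun y : ℝ ↦ y ^ 2 / 4).locallyIntegrable
  refine hg.mono χ.measurable_tentSum.aestronglyMeasurable (ae_of_all _ fun y ↦ ?_)
  rcases le_or_gt 0 y with hy | hy
  · exact (norm_tentSum_le_sq hy).trans (le_abs_self _)
  · rw [tentSum_eq_zero (by linarith), norm_zero]
    exact norm_nonneg _

lemma isBigO_tentSum_nhds_zero (b : ℝ) :
    tentSum χ =O[𝓝[>] 0] fun y : ℝ ↦ y ^ (-b) := by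
  refine IsBigO.of_bound 0 ?_
  filter_upwards [Ioo_mem_nhdsGT (zero_lt_one' ℝ)] with y hy
  simp [tentSum_eq_zero hy.2.le]

variable {χ}

lemma isBigO_tentSum_atTop [NeZero q] (hχ : χ.IsPrimitive) (h1 : χ ≠ 1) :
    tentSum χ =O[atTop] fun y : ℝ ↦ y ^ (-(-1) : ℝ) := by
  refine IsBigO.of_bound (√q / 2) ?_
  filter_upwards [eventually_ge_atTop 0] with y hy
  rw [neg_neg, Real.rpow_one, Real.norm_of_nonneg hy]
  exact (norm_tentSum_le hχ h1 hy).trans_eq (by ring)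

lemma mellin_tentSum_of_one_lt [NeZero q] {s : ℂ} (hs : 1 < s.re) :
    mellin (tentSum χ) (-s - 1) =
      (1 - (2 : ℂ) ^ (-s)) / (s * (s + 1)) * LFunction χ s := by
  have hs0 : 0 < s.re := by linarith
  set C : ℂ → ℂ := fun s ↦ (1 - (2 : ℂ) ^ (-s)) / (s * (s + 1))
  let F : ℕ → ℝ → ℂ := fun n y ↦ (y : ℂ) ^ (-s - 1 - 1) • (χ n * (tent y n : ℂ))
  have hF (n : ℕ) : IntegrableOn (F n) (Ioi 0) ∧
      ∫ y in Ioi 0, F n y = C s * LSeries.term (χ ·) s n := by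
    rcases eq_or_ne n 0 with rfl | hn
    · have : F 0 = fun _ ↦ 0 := by ext y; simp [F, tent]
      rw [this]
      simp
    · have h := hasMellin_const_smul (hasMellin_tent hn hs0).1 (χ n)
      refine ⟨h.1, h.2.trans ?_⟩
      rw [(hasMellin_tent hn hs0).2, LSeries.term_of_ne_zero hn, cpow_neg (n : ℂ), smul_eq_mul]
      ring
  -- The tent is nonnegative, so the integral of the norm is at most its own Mellin transform at the
  -- real point `s.re`. The bounds are summable for `s.re > 1`, which justifies termwise
  -- integration.
  have hnorm (n : ℕ) : ∫ y in Ioi 0, ‖F n y‖ ≤ ‖C s.re‖ * (n : ℝ) ^ (-s.re) := by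
    rcases eq_or_ne n 0 with rfl | hn
    · have : F 0 = fun _ ↦ 0 := by ext y; simp [F, tent]
      rw [this]
      simp
      positivity
    · have h := hasMellin_tent hn (s := (s.re : ℂ)) (by simpa using hs0)
      have hreal : EqOn (fun y : ℝ ↦ (y : ℂ) ^ (-(s.re : ℂ) - 1 - 1) • (tent y n : ℂ))
          (fun y : ℝ ↦ ((y ^ (-s.re - 1 - 1) * tent y n : ℝ) : ℂ)) (Ioi 0) := by
        intro y (hy : 0 < y)
        simp only [smul_eq_mul]
        rw [ofReal_mul, ofReal_cpow hy.le]
        push_cast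
        rfl
      have hint : IntegrableOn (fun y : ℝ ↦ y ^ (-s.re - 1 - 1) * tent y n) (Ioi 0) := by
        have := (integrableOn_congr_fun hreal measurableSet_Ioi).mp h.1
        exact this.re
      have hle : ∫ y in Ioi 0, ‖F n y‖ ≤ ∫ y in Ioi (0 : ℝ), y ^ (-s.re - 1 - 1) * tent y n := by
        refine setIntegral_mono_on (hF n).1.norm hint measurableSet_Ioi fun y hy ↦ ?_
        simp only [F, norm_smul, norm_mul]
        rw [norm_cpow_eq_rpow_re_of_pos hy, Complex.norm_real, Real.norm_of_nonneg (tent_nonneg y n)]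
        simp only [sub_re, neg_re, one_re]
        have := tent_nonneg y n
        have hy' := Real.rpow_nonneg (le_of_lt hy) (-s.re - 1 - 1)
        gcongr
        exact mul_le_of_le_one_left this (χ.norm_le_one _)
      refine hle.trans ?_
      have hval := h.2
      rw [mellin, setIntegral_congr_fun measurableSet_Ioi hreal, integral_complex_ofReal] at hval
      have := congrArg norm hval
      rw [norm_mul, Complex.norm_real, norm_natCast_cpow_of_pos (Nat.pos_of_ne_zero hn)] at this
      simpa only [neg_re, ofReal_re] using (le_abs_self _).trans_eq this
  have hsum : Summable fun n ↦ ∫ y in Ioi 0, ‖F n y‖ := by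
    refine Summable.of_nonneg_of_le (fun n ↦ by positivity) hnorm (Summable.mul_left _ ?_)
    exact Real.summable_nat_rpow.mpr (by linarith)
  have key := hasSum_integral_of_summable_integral_norm (fun n ↦ (hF n).1) hsum
  have e : mellin (tentSum χ) (-s - 1) = ∫ y in Ioi 0, ∑' n, F n y := by
    rw [mellin]
    congr 1 with y
    exact (((hasSum_tentSum χ y).const_smul _).tsum_eq).symm
  rw [e, ← key.tsum_eq, LFunction_eq_LSeries χ hs, LSeries, ← tsum_mul_left]
  exact tsum_congr fun n ↦ (hF n).2

/-- Linear growth at infinity requires `Re (-s - 1) < -1`, that is `Re s > 0`. Near zero the sum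
vanishes, so any exponent `b` below `Re (-s - 1)` serves; `-s.re - 2` is one. -/
lemma hasDerivAt_mellin_tentSum [NeZero q] (hχ : χ.IsPrimitive) (h1 : χ ≠ 1) {s : ℂ}
    (hs : 0 < s.re) :
    MellinConvergent (fun t ↦ Real.log t • tentSum χ t) (-s - 1) ∧
      HasDerivAt (mellin (tentSum χ)) (mellin (fun t ↦ Real.log t • tentSum χ t) (-s - 1))
        (-s - 1) :=
  mellin_hasDerivAt_of_isBigO_rpow (b := -s.re - 2)
    (χ.locallyIntegrable_tentSum.locallyIntegrableOn _) (isBigO_tentSum_atTop hχ h1)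
    (by simp; linarith) (χ.isBigO_tentSum_nhds_zero _) (by simp)

lemma mellinConvergent_tentSum [NeZero q] (hχ : χ.IsPrimitive) (h1 : χ ≠ 1) {s : ℂ}
    (hs : 0 < s.re) : MellinConvergent (tentSum χ) (-s - 1) :=
  mellinConvergent_of_isBigO_rpow (b := -s.re - 2)
    (χ.locallyIntegrable_tentSum.locallyIntegrableOn _) (isBigO_tentSum_atTop hχ h1)
    (by simp; linarith) (χ.isBigO_tentSum_nhds_zero _) (by simp)

/-- Both sides are analytic on `Re s > 0` and agree near `2`, so the identity theorem applies. -/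
lemma mul_mellin_tentSum [NeZero q] (hχ : χ.IsPrimitive) (h1 : χ ≠ 1) {s : ℂ} (hs : 0 < s.re) :
    s * (s + 1) * mellin (tentSum χ) (-s - 1) = (1 - (2 : ℂ) ^ (-s)) * LFunction χ s := by
  have hopen : IsOpen {s : ℂ | 0 < s.re} := isOpen_lt continuous_const continuous_re
  have hf : AnalyticOnNhd ℂ (fun s ↦ s * (s + 1) * mellin (tentSum χ) (-s - 1))
      {s : ℂ | 0 < s.re} := by
    refine DifferentiableOn.analyticOnNhd (fun z hz ↦ ?_) hopen
    have hm : DifferentiableAt ℂ (fun s ↦ mellin (tentSum χ) (-s - 1)) z :=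
      DifferentiableAt.comp (g := mellin (tentSum χ)) z
        (hasDerivAt_mellin_tentSum hχ h1 hz).2.differentiableAt (by fun_prop : DifferentiableAt ℂ (fun s ↦ -s - 1) z)
    exact (by fun_prop : DifferentiableAt ℂ _ z).differentiableWithinAt
  have hg : AnalyticOnNhd ℂ (fun s ↦ (1 - (2 : ℂ) ^ (-s)) * LFunction χ s)
      {s : ℂ | 0 < s.re} := by
    refine DifferentiableOn.analyticOnNhd (fun z hz ↦ ?_) hopen
    have hL := differentiable_LFunction h1 z
    have h2 : DifferentiableAt ℂ (fun s ↦ (2 : ℂ) ^ (-s)) z :=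
      (differentiableAt_id.neg).const_cpow (Or.inl two_ne_zero)
    exact (by fun_prop : DifferentiableAt ℂ _ z).differentiableWithinAt
  refine hf.eqOn_of_preconnected_of_eventuallyEq hg
    (convex_halfSpace_re_gt 0).isPreconnected (z₀ := 2) (by simp) ?_ hs
  filter_upwards [(isOpen_lt continuous_const continuous_re).mem_nhds
    (show (2 : ℂ) ∈ {s : ℂ | 1 < s.re} by simp)] with z hz
  have hz' : 1 < z.re := hz
  have hz0 : z ≠ 0 := fun h ↦ by simp [h] at hz'; linarith
  have hz1 : z + 1 ≠ 0 := fun h ↦ by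
    have := congrArg re h
    simp at this
    linarith
  rw [mellin_tentSum_of_one_lt hz']
  field_simp

end DirichletCharacter

end

/-! ### Integrals against a logarithmic weight -/

section

open MeasureTheory Set Filter Asymptotics Topology

section LogIntegrals

variable {Y σ : ℝ}

lemma intervalIntegrable_log_sub_log_div (hY : 1 ≤ Y) :
    IntervalIntegrable (fun y ↦ (Real.log Y - Real.log y) / y) volume 1 Y := by
  refine ContinuousOn.intervalIntegrable fun y hy ↦ ContinuousAt.continuousWithinAt ?_
  rw [uIcc_of_le hY] at hy
  have : y ≠ 0 := by linarith [hy.1]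
  fun_prop (disch := assumption)

lemma integral_log_sub_log_div (hY : 1 ≤ Y) :
    ∫ y in 1..Y, (Real.log Y - Real.log y) / y = Real.log Y ^ 2 / 2 := by
  have h : ∀ y ∈ uIcc 1 Y, HasDerivAt (fun y ↦ -((Real.log Y - Real.log y) ^ 2 / 2))
      ((Real.log Y - Real.log y) / y) y := by
    intro y hy
    rw [uIcc_of_le hY] at hy
    have hy0 : y ≠ 0 := by linarith [hy.1]
    refine ((((Real.hasDerivAt_log hy0).const_sub (Real.log Y)).pow 2).div_const 2).neg.congr_deriv
      ?_
    push_cast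
    field_simp
  rw [intervalIntegral.integral_eq_sub_of_hasDerivAt h (intervalIntegrable_log_sub_log_div hY)]
  simp

lemma integrableOn_and_integral_log_sub_log_mul_rpow (hY : 0 < Y) (hσ : 0 < σ) :
    IntegrableOn (fun y ↦ (Real.log y - Real.log Y) * y ^ (-σ - 1)) (Ioi Y) ∧
      ∫ y in Ioi Y, (Real.log y - Real.log Y) * y ^ (-σ - 1) = Y ^ (-σ) / σ ^ 2 := by
  let G : ℝ → ℝ := fun y ↦ -(((Real.log y - Real.log Y) / σ + 1 / σ ^ 2) * y ^ (-σ))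
  have hderiv : ∀ y ∈ Ici Y, HasDerivAt G ((Real.log y - Real.log Y) * y ^ (-σ - 1)) y := by
    intro y (hy : Y ≤ y)
    have hy0 : 0 < y := hY.trans_le hy
    have hp : y ^ (-σ) = y ^ (-σ - 1) * y := by
      rw [Real.rpow_sub_one hy0.ne', div_mul_cancel₀ _ hy0.ne']
    refine HasDerivAt.congr_deriv (((((Real.hasDerivAt_log hy0.ne').sub_const (Real.log Y)).div_const σ).add_const
      (1 / σ ^ 2)).mul (Real.hasDerivAt_rpow_const (p := -σ) (Or.inl hy0.ne'))).neg ?_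
    rw [hp]
    field_simp
    ring
  have hlim : Tendsto G atTop (𝓝 0) := by
    have h1 : Tendsto (fun y : ℝ ↦ y ^ (-σ)) atTop (𝓝 0) := tendsto_rpow_neg_atTop hσ
    have h2 : Tendsto (fun y : ℝ ↦ Real.log y * y ^ (-σ)) atTop (𝓝 0) := by
      refine (isLittleO_log_rpow_atTop hσ).tendsto_div_nhds_zero.congr' ?_
      filter_upwards [eventually_gt_atTop 0] with y hy
      rw [Real.rpow_neg hy.le, div_eq_mul_inv]
    have h3 := ((h2.const_mul (1 / σ)).add
      (h1.const_mul (1 / σ ^ 2 - Real.log Y / σ))).neg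
    simp only [mul_zero, add_zero, neg_zero] at h3
    refine h3.congr fun y ↦ ?_
    simp only [G]
    ring
  have hpos : ∀ y ∈ Ioi Y, 0 ≤ (Real.log y - Real.log Y) * y ^ (-σ - 1) := by
    intro y (hy : Y < y)
    have := Real.log_le_log hY hy.le
    have := Real.rpow_nonneg (hY.trans hy).le (-σ - 1)
    exact mul_nonneg (by linarith) this
  refine ⟨integrableOn_Ioi_deriv_of_nonneg' hderiv hpos hlim, ?_⟩
  rw [integral_Ioi_of_hasDerivAt_of_nonneg' hderiv hpos hlim]
  simp [G]
  ring

/-- The integral is split at `Y`, where the logarithmic weight changes sign. On `(1, Y]` the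
quadratic bound leaves `y^(1-σ) / (4y)`, and `y^(1-σ)` is replaced by `Y^(1-σ)`; on `(Y, ∞)` the
linear bound is integrated exactly. -/
lemma norm_integral_log_mul_rpow_mul_le {f : ℝ → ℂ} {Q : ℝ} (hY : 1 ≤ Y) (hσ : 0 < σ)
    (hσ1 : σ ≤ 1) (h0 : ∀ y ≤ 1, f y = 0) (h1 : ∀ y, 0 ≤ y → ‖f y‖ ≤ y ^ 2 / 4)
    (h2 : ∀ y, 0 ≤ y → ‖f y‖ ≤ Q * (y / 2)) :
    ‖∫ y in Ioi 0, ((Real.log y - Real.log Y : ℝ) : ℂ) * ((y ^ (-σ - 2) : ℝ) : ℂ) * f y‖ ≤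
      Y ^ (1 - σ) * Real.log Y ^ 2 / 8 + Q * Y ^ (-σ) / (2 * σ ^ 2) := by
  have hY0 : 0 < Y := by linarith
  obtain ⟨i2, v2⟩ := integrableOn_and_integral_log_sub_log_mul_rpow hY0 hσ
  have i1 := (intervalIntegrable_iff_integrableOn_Ioc_of_le hY).mp
    (intervalIntegrable_log_sub_log_div hY)
  have v1 := integral_log_sub_log_div hY
  rw [intervalIntegral.integral_of_le hY] at v1
  let g1 : ℝ → ℝ := fun y ↦ Y ^ (1 - σ) / 4 * ((Real.log Y - Real.log y) / y)
  let g2 : ℝ → ℝ := fun y ↦ Q / 2 * ((Real.log y - Real.log Y) * y ^ (-σ - 1))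
  have j1 : IntegrableOn ((Ioc 1 Y).indicator g1) (Ioi 0) :=
    (IntegrableOn.integrable_indicator (i1.const_mul _) measurableSet_Ioc).integrableOn
  have j2 : IntegrableOn ((Ioi Y).indicator g2) (Ioi 0) :=
    (IntegrableOn.integrable_indicator (i2.const_mul _) measurableSet_Ioi).integrableOn
  have s1 : Ioi 0 ∩ Ioc 1 Y = Ioc 1 Y :=
    inter_eq_right.mpr fun y hy ↦ zero_lt_one.trans hy.1
  have s2 : Ioi 0 ∩ Ioi Y = Ioi Y := inter_eq_right.mpr (Ioi_subset_Ioi hY0.le)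
  have hval : ∫ y in Ioi 0, ((Ioc 1 Y).indicator g1 y + (Ioi Y).indicator g2 y) =
      Y ^ (1 - σ) * Real.log Y ^ 2 / 8 + Q * Y ^ (-σ) / (2 * σ ^ 2) := by
    rw [integral_add j1 j2, setIntegral_indicator measurableSet_Ioc,
      setIntegral_indicator measurableSet_Ioi, s1, s2, integral_const_mul, integral_const_mul,
      v1, v2]
    ring
  rw [← hval]
  refine norm_integral_le_of_norm_le (j1.add j2) ?_
  filter_upwards [ae_restrict_mem measurableSet_Ioi] with y hy
  have hy0 : 0 < y := hy
  rw [norm_mul, norm_mul, Complex.norm_real, Complex.norm_real,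
    Real.norm_of_nonneg (Real.rpow_nonneg hy0.le _), Real.norm_eq_abs]
  have hpow : y ^ (-σ - 2) * y = y ^ (-σ - 1) := by
    rw [← Real.rpow_add_one hy0.ne']; congr 1; ring
  rcases le_or_gt y 1 with hy1 | hy1
  · rw [h0 y hy1, norm_zero, mul_zero, indicator_of_notMem (fun h ↦ hy1.not_gt h.1),
      indicator_of_notMem (s := Ioi Y) (fun h ↦ (hy1.trans hY).not_gt h), add_zero]
  rcases le_or_gt y Y with hyY | hyY
  · have hlog := Real.log_le_log hy0 hyY
    rw [indicator_of_mem (show y ∈ Ioc 1 Y from ⟨hy1, hyY⟩),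
      indicator_of_notMem (s := Ioi Y) (fun h ↦ hyY.not_gt h), add_zero, abs_of_nonpos (by linarith)]
    have hp : y ^ (1 - σ) ≤ Y ^ (1 - σ) := Real.rpow_le_rpow hy0.le hyY (by linarith)
    have hp2 : y ^ (-σ - 1) * y ^ 2 = y ^ (1 - σ) := by
      rw [← Real.rpow_natCast y 2, ← Real.rpow_add hy0]; congr 1; push_cast; ring
    calc _ ≤ -(Real.log y - Real.log Y) * y ^ (-σ - 2) * (y ^ 2 / 4) := by
          have := Real.rpow_nonneg hy0.le (-σ - 2)
          have : 0 ≤ -(Real.log y - Real.log Y) := by linarith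
          gcongr
          exact h1 y hy0.le
      _ = y ^ (1 - σ) / 4 * ((Real.log Y - Real.log y) / y) := by
          rw [← hp2, ← hpow]
          field_simp
          ring
      _ ≤ g1 y := by
          have : 0 ≤ (Real.log Y - Real.log y) / y := div_nonneg (by linarith) hy0.le
          simp only [g1]
          gcongr
  · have hlog := Real.log_le_log hY0 hyY.le
    rw [indicator_of_notMem (fun h ↦ hyY.not_ge h.2),
      indicator_of_mem (show y ∈ Ioi Y from hyY), zero_add, abs_of_nonneg (by linarith)]
    calc _ ≤ (Real.log y - Real.log Y) * y ^ (-σ - 2) * (Q * (y / 2)) := by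
          have := Real.rpow_nonneg hy0.le (-σ - 2)
          have : 0 ≤ Real.log y - Real.log Y := by linarith
          gcongr
          exact h2 y hy0.le
      _ = g2 y := by
          simp only [g2]
          rw [← hpow]
          ring

end LogIntegrals

/-- Bernoulli's inequality for `(1 - 1/2)^σ`, with equality at both endpoints. -/
lemma two_rpow_neg_le_one_sub_half {σ : ℝ} (h0 : 0 ≤ σ) (h1 : σ ≤ 1) :
    (2 : ℝ) ^ (-σ) ≤ 1 - σ / 2 := by
  have h := rpow_one_add_le_one_add_mul_self (s := -(1 / 2)) (by norm_num) h0 h1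
  rw [Real.rpow_neg zero_le_two, ← Real.inv_rpow zero_le_two]
  convert h using 1
  · norm_num
  · ring

/-! ### The derivative of `L` near an exceptional zero -/

namespace DirichletCharacter

variable {q : ℕ} [NeZero q] {χ : DirichletCharacter ℂ q}

/-- The logarithmic derivative of `(1 - 2⁻ˢ) Yˢ / (s (s + 1))` at `s = σ`. -/
noncomputable def tentLogDeriv (Y σ : ℝ) : ℝ :=
  Real.log Y + Real.log 2 * 2 ^ (-σ) / (1 - 2 ^ (-σ)) - (2 * σ + 1) / (σ * (σ + 1))

/-- The terms added to `log Y` total between `-2` and `0`, and `log Y - 2 ≥ -log Y` because `log Y ≥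
1`. -/
lemma abs_tentLogDeriv_le {Y σ : ℝ} (hY : 1 ≤ Real.log Y) (h0 : 3 / 4 ≤ σ) (h1 : σ ≤ 1) :
    |tentLogDeriv Y σ| ≤ Real.log Y := by
  have hp := two_rpow_neg_le_one_sub_half (by linarith : 0 ≤ σ) h1
  have hp0 : (0 : ℝ) < 2 ^ (-σ) := by positivity
  have hE : 0 < 1 - (2 : ℝ) ^ (-σ) := by linarith
  have hl0 := Real.log_two_gt_d9
  have hl1 := Real.log_two_lt_d9
  have a1 : 0 ≤ Real.log 2 * 2 ^ (-σ) / (1 - 2 ^ (-σ)) := by positivity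
  have a2 : Real.log 2 * 2 ^ (-σ) / (1 - 2 ^ (-σ)) ≤ 5 / 4 := by
    rw [div_le_iff₀ hE]
    nlinarith
  have a3 : (2 * σ + 1) / (σ * (σ + 1)) ≤ 2 := by
    rw [div_le_iff₀ (by nlinarith)]
    nlinarith
  have a4 : 5 / 4 ≤ (2 * σ + 1) / (σ * (σ + 1)) := by
    rw [le_div_iff₀ (by nlinarith)]
    nlinarith
  rw [abs_le, tentLogDeriv]
  constructor <;> linarith

/-- Differentiation of `mul_mellin_tentSum` produces the weight `log y`. Replacing it by `log y -
log Y` costs only a multiple of the Mellin transform itself, hence of `L(σ)`, which is small near a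
zero. -/
lemma deriv_LFunction_eq (hχ : χ.IsPrimitive) (h1 : χ ≠ 1) (Y : ℝ) {σ : ℝ} (hσ : 0 < σ) :
    deriv (LFunction χ) σ = -((tentLogDeriv Y σ : ℝ) : ℂ) * LFunction χ σ -
      ((σ * (σ + 1) / (1 - 2 ^ (-σ)) : ℝ) : ℂ) *
        ∫ y in Ioi 0, ((Real.log y - Real.log Y : ℝ) : ℂ) * ((y ^ (-σ - 2) : ℝ) : ℂ) *
          tentSum χ y := by
  have hσ' : 0 < (σ : ℂ).re := by simpa using hσ
  obtain ⟨c1, d1⟩ := hasDerivAt_mellin_tentSum hχ h1 hσ'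
  have c0 := mellinConvergent_tentSum hχ h1 hσ'
  have hint : ∫ y in Ioi 0, ((Real.log y - Real.log Y : ℝ) : ℂ) * ((y ^ (-σ - 2) : ℝ) : ℂ) *
      tentSum χ y = mellin (fun t ↦ Real.log t • tentSum χ t) (-(σ : ℂ) - 1) -
        Real.log Y * mellin (tentSum χ) (-(σ : ℂ) - 1) := by
    rw [mellin, mellin, ← integral_const_mul, ← integral_sub c1 (c0.const_mul _)]
    refine setIntegral_congr_fun measurableSet_Ioi fun y (hy : 0 < y) ↦ ?_
    have : ((y ^ (-σ - 2) : ℝ) : ℂ) = (y : ℂ) ^ (-(σ : ℂ) - 1 - 1) := by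
      rw [Complex.ofReal_cpow hy.le]
      congr 1
      push_cast
      ring
    simp only [this, smul_eq_mul, Complex.real_smul]
    push_cast
    ring
  set m := mellin (tentSum χ) (-(σ : ℂ) - 1) with hm
  set m' := mellin (fun t ↦ Real.log t • tentSum χ t) (-(σ : ℂ) - 1)
  have hp1 : (2 : ℝ) ^ (-σ) < 1 :=
    Real.rpow_lt_one_of_one_lt_of_neg one_lt_two (by linarith)
  obtain ⟨p, hp⟩ : ∃ p : ℝ, p = 2 ^ (-σ) := ⟨_, rfl⟩
  have hpC : (2 : ℂ) ^ (-(σ : ℂ)) = (p : ℂ) := by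
    rw [hp, Complex.ofReal_cpow zero_le_two]
    push_cast
    rfl
  have hm_eq := mul_mellin_tentSum hχ h1 hσ'
  rw [← hm, hpC] at hm_eq
  have hd1 : HasDerivAt (fun s : ℂ ↦ s * (s + 1) * mellin (tentSum χ) (-s - 1))
      ((2 * σ + 1) * m - σ * (σ + 1) * m') σ := by
    have e1 : HasDerivAt (fun s : ℂ ↦ s * (s + 1)) (2 * σ + 1) (σ : ℂ) := by
      refine ((hasDerivAt_id (σ : ℂ)).mul ((hasDerivAt_id (σ : ℂ)).add_const 1)).congr_deriv ?_
      simp only [id]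
      ring
    have e2 : HasDerivAt (fun s : ℂ ↦ -s - 1) (-1) (σ : ℂ) :=
      (hasDerivAt_id (σ : ℂ)).neg.sub_const 1
    refine (e1.mul (HasDerivAt.comp (h₂ := mellin (tentSum χ)) (σ : ℂ) d1 e2)).congr_deriv ?_
    simp only [Function.comp, ← hm]
    ring
  have hd2 : HasDerivAt (fun s : ℂ ↦ (1 - (2 : ℂ) ^ (-s)) * LFunction χ s)
      (Real.log 2 * p * LFunction χ σ + (1 - p) * deriv (LFunction χ) σ) σ := by
    have e1 : HasDerivAt (fun s : ℂ ↦ 1 - (2 : ℂ) ^ (-s)) (Real.log 2 * p) (σ : ℂ) := by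
      refine (((hasDerivAt_id (σ : ℂ)).neg.const_cpow (c := 2)
        (Or.inl two_ne_zero)).const_sub 1).congr_deriv ?_
      simp only [id, Pi.neg_apply, hpC]
      rw [show (2 : ℂ) = ((2 : ℝ) : ℂ) by simp, ← Complex.ofReal_log zero_le_two]
      ring
    refine (e1.mul (differentiable_LFunction h1 (σ : ℂ)).hasDerivAt).congr_deriv ?_
    rw [hpC]
  have hev : (fun s : ℂ ↦ s * (s + 1) * mellin (tentSum χ) (-s - 1)) =ᶠ[𝓝 (σ : ℂ)]
      fun s : ℂ ↦ (1 - (2 : ℂ) ^ (-s)) * LFunction χ s := by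
    filter_upwards [(isOpen_lt continuous_const Complex.continuous_re).mem_nhds hσ'] with s hs
    exact mul_mellin_tentSum hχ h1 hs
  have hderiv := hd1.unique (hd2.congr_of_eventuallyEq hev)
  have hs0 : (σ : ℂ) ≠ 0 := by exact_mod_cast hσ.ne'
  have hs1 : (σ : ℂ) + 1 ≠ 0 := by exact_mod_cast (by linarith : σ + 1 ≠ 0)
  have hE : (1 : ℂ) - p ≠ 0 := by
    rw [hp]
    exact_mod_cast (by linarith : 1 - (2 : ℝ) ^ (-σ) ≠ 0)
  have hm_val : m = (1 - p) * LFunction χ σ / (σ * (σ + 1)) := by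
    rw [← hm_eq]
    field_simp
  have hm'_val : m' = ((2 * σ + 1) * m - Real.log 2 * p * LFunction χ σ -
      (1 - p) * deriv (LFunction χ) σ) / (σ * (σ + 1)) := by
    rw [eq_div_iff (mul_ne_zero hs0 hs1)]
    linear_combination -hderiv
  rw [hint, tentLogDeriv, ← hp]
  push_cast
  rw [hm'_val, hm_val]
  field_simp
  ring

lemma norm_deriv_LFunction_le (hχ : χ.IsPrimitive) (h1 : χ ≠ 1) {Y σ : ℝ} (hY : √q = 2 * Y)
    (hlog : 1 ≤ Real.log Y) (h34 : 3 / 4 ≤ σ) (hσ1 : σ ≤ 1) :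
    ‖deriv (LFunction χ) σ‖ ≤ Real.log Y * ‖LFunction χ σ‖ +
      Y ^ (1 - σ) * (Real.log Y ^ 2 / 2 + 4 / σ ^ 2) := by
  have hσ : 0 < σ := by linarith
  have hY0 : 0 ≤ Y := by linarith [Real.sqrt_nonneg q]
  have hY1 : 1 ≤ Y := by
    by_contra! h
    linarith [Real.log_nonpos hY0 h.le]
  have hp := two_rpow_neg_le_one_sub_half hσ.le hσ1
  have hE : 0 < 1 - (2 : ℝ) ^ (-σ) := by linarith
  have hint := norm_integral_log_mul_rpow_mul_le hY1 hσ hσ1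
    (fun y hy ↦ tentSum_eq_zero (χ := χ) hy) (fun y hy ↦ norm_tentSum_le_sq hy)
    (fun y hy ↦ norm_tentSum_le hχ h1 hy)
  -- Since `1 - 2^(-σ) ≥ σ / 2`, the quotient is at most `2 (σ + 1) ≤ 4`.
  have hD : σ * (σ + 1) / (1 - 2 ^ (-σ)) ≤ 4 := by
    rw [div_le_iff₀ hE]
    nlinarith
  have hD0 : 0 ≤ σ * (σ + 1) / (1 - 2 ^ (-σ)) := by positivity
  rw [deriv_LFunction_eq hχ h1 Y hσ]
  refine (norm_sub_le _ _).trans ?_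
  rw [norm_mul, norm_mul, norm_neg, Complex.norm_real, Complex.norm_real, Real.norm_eq_abs,
    Real.norm_of_nonneg hD0]
  have hYp : Y ^ (1 - σ) = Y * Y ^ (-σ) := by
    rw [sub_eq_add_neg, Real.rpow_add (by linarith), Real.rpow_one]
  refine add_le_add ?_ ?_
  · gcongr
    exact abs_tentLogDeriv_le hlog h34 hσ1
  · refine (mul_le_mul hD hint (norm_nonneg _) (by norm_num)).trans_eq ?_
    rw [hY, hYp]
    field_simp
    ring

/-- If `L(β, χ) = 0`, then `L(·, χ)` is small on `[β, 1]`, so its derivative there is controlled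
by the inhomogeneous term of `norm_deriv_LFunction_le`. -/
lemma norm_deriv_LFunction_mul_le_of_zero (hχ : χ.IsPrimitive) (h1 : χ ≠ 1) {Y β : ℝ}
    (hY : √q = 2 * Y) (hlog : 1 ≤ Real.log Y) (h34 : 3 / 4 ≤ β) (hβ : LFunction χ β = 0)
    {σ : ℝ} (hσ : σ ∈ Icc β 1) :
    ‖deriv (LFunction χ) σ‖ * (1 - (1 - β) * Real.log Y) ≤
      Y ^ (1 - β) * (Real.log Y ^ 2 / 2 + 4 / β ^ 2) := by
  have hY1 : 1 ≤ Y := by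
    by_contra! h
    linarith [Real.log_nonpos (by linarith [Real.sqrt_nonneg q]) h.le]
  have hdiff := differentiable_LFunction h1
  have hcont : Continuous fun x : ℝ ↦ ‖deriv (LFunction χ) x‖ :=
    ((hdiff.contDiff (n := 1)).continuous_deriv le_rfl |>.comp Complex.continuous_ofReal).norm
  -- The derivative estimate is applied where `|L'|` is maximal on `[β, 1]`: there the mean value
  -- bound for `L` is in terms of the same maximum, which can be moved to the left-hand side.
  obtain ⟨τ, hτ, hmax⟩ := isCompact_Icc.exists_isMaxOn ⟨σ, hσ⟩ hcont.continuousOn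
  set M := ‖deriv (LFunction χ) τ‖
  have hM : ∀ x ∈ Icc β 1, ‖deriv (LFunction χ) x‖ ≤ M := fun x hx ↦ hmax hx
  have hL : ‖LFunction χ τ‖ ≤ M * (1 - β) := by
    have h := Convex.norm_image_sub_le_of_norm_hasDerivWithin_le
      (f := fun x : ℝ ↦ LFunction χ x) (f' := fun x : ℝ ↦ deriv (LFunction χ) x) (C := M)
      (s := Icc β 1) (x := β) (y := τ)
      (fun x _ ↦ ((hdiff x).hasDerivAt.comp_ofReal).hasDerivWithinAt) hM (convex_Icc β 1)
      ⟨le_rfl, hτ.1.trans hτ.2⟩ hτ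
    rw [hβ, sub_zero, Real.norm_of_nonneg (by linarith [hτ.1])] at h
    refine h.trans ?_
    have := hτ.2
    gcongr
  have hbound := norm_deriv_LFunction_le hχ h1 hY hlog (h34.trans hτ.1) hτ.2
  have hmono : Y ^ (1 - τ) * (Real.log Y ^ 2 / 2 + 4 / τ ^ 2) ≤
      Y ^ (1 - β) * (Real.log Y ^ 2 / 2 + 4 / β ^ 2) := by
    have := hτ.1
    gcongr
  have hmul := mul_le_mul_of_nonneg_left hL (by linarith : 0 ≤ Real.log Y)
  have hkey : M * (1 - (1 - β) * Real.log Y) ≤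
      Y ^ (1 - β) * (Real.log Y ^ 2 / 2 + 4 / β ^ 2) := by
    linarith
  have hβ1 : β ≤ 1 := hσ.1.trans hσ.2
  rcases le_or_gt 0 (1 - (1 - β) * Real.log Y) with h | h
  · exact (mul_le_mul_of_nonneg_right (hM σ hσ) h).trans hkey
  · refine (mul_nonpos_of_nonneg_of_nonpos (norm_nonneg _) h.le).trans ?_
    positivity

lemma ne_one_of_isPrimitive (hχ : χ.IsPrimitive) (hq : 1 < q) : χ ≠ 1 := by
  rintro rfl
  rw [isPrimitive_def, conductor_one] at hχ
  omega

/-- The bound for `L'` near an exceptional zero, for primitive characters of either parity. -/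
lemma norm_deriv_LFunction_le_of_isExceptionalZero (hχ : χ.IsPrimitive) {β : ℝ}
    (hβ : IsExceptionalZero χ β) (hq : 4 * 10 ^ 5 < q) {σ : ℝ} (hσ : σ ∈ Ioo β 1) :
    ‖deriv (LFunction χ) σ‖ ≤ 0.15 * Real.log q ^ 2 := by
  have hqR : (4 * 10 ^ 5 : ℝ) < q := by exact_mod_cast hq
  have hq0 : (0 : ℝ) < q := by linarith
  have h1 := ne_one_of_isPrimitive hχ (by omega)
  obtain ⟨hβ1, hβ0⟩ := hβ
  rw [max_eq_left (by linarith)] at hβ1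
  have hl0 := Real.log_two_gt_d9
  have hl1 := Real.log_two_lt_d9
  have hℓ : 12.4 ≤ Real.log q := by
    have := Real.log_le_log (by norm_num) (by linarith : (2 : ℝ) ^ 18 ≤ q)
    rw [Real.log_pow] at this
    push_cast at this
    linarith
  obtain ⟨Y, hY⟩ : ∃ Y, Y = √q / 2 := ⟨_, rfl⟩
  have hY0 : 0 < Y := by rw [hY]; positivity
  have hlogY : Real.log Y = Real.log q / 2 - Real.log 2 := by
    rw [hY, Real.log_div (by positivity) two_ne_zero, Real.log_sqrt hq0.le]
  -- `0.10368` rounds up `1 / 9.6459`; its half `0.05184` serves for `log Y`, since `log Y < (log q)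
  -- / 2`.
  have hδ : (1 - β) * Real.log q ≤ 0.10368 := by
    have : (1 - β) ≤ (9.6459 * Real.log q)⁻¹ := by linarith
    calc (1 - β) * Real.log q ≤ (9.6459 * Real.log q)⁻¹ * Real.log q := by gcongr
      _ = (9.6459)⁻¹ := by field_simp
      _ ≤ _ := by norm_num
  have hβlt : β < 1 := hσ.1.trans hσ.2
  have hδ1 : 1 - β ≤ 0.0084 := by nlinarith
  have hδY : (1 - β) * Real.log Y ≤ 0.05184 := by
    rw [hlogY]
    nlinarith
  have hmain := norm_deriv_LFunction_mul_le_of_zero hχ h1 (by linarith : √q = 2 * Y) (by linarith)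
    (by linarith) hβ0 (Ioo_subset_Icc_self hσ)
  -- From `1 - x ≤ exp (-x)` with `x = (1 - β) log Y`: the factor `Y^(1-β)` costs the same `1 / (1 -
  -- 0.05184)` as the absorption of `L(σ)`.
  have hYpow : Y ^ (1 - β) * (1 - 0.05184) ≤ 1 := by
    rw [Real.rpow_def_of_pos hY0, mul_comm (Real.log Y)]
    calc Real.exp ((1 - β) * Real.log Y) * (1 - 0.05184)
        ≤ Real.exp ((1 - β) * Real.log Y) * Real.exp (-((1 - β) * Real.log Y)) := by
          gcongr
          linarith [Real.add_one_le_exp (-((1 - β) * Real.log Y))]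
      _ = 1 := by rw [← Real.exp_add, add_neg_cancel, Real.exp_zero]
  have hβ2 : 4 / β ^ 2 ≤ 4.1 := by
    rw [div_le_iff₀ (by nlinarith)]
    nlinarith
  set D := ‖deriv (LFunction χ) σ‖
  have hD : 0 ≤ D := norm_nonneg _
  have step1 : D * (1 - 0.05184) ≤ Y ^ (1 - β) * (Real.log Y ^ 2 / 2 + 4.1) :=
    calc D * (1 - 0.05184) ≤ D * (1 - (1 - β) * Real.log Y) := by gcongr
      _ ≤ _ := hmain
      _ ≤ _ := by gcongr
  have step2 : D * (1 - 0.05184) * (1 - 0.05184) ≤ Real.log Y ^ 2 / 2 + 4.1 :=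
    calc D * (1 - 0.05184) * (1 - 0.05184)
        ≤ Y ^ (1 - β) * (Real.log Y ^ 2 / 2 + 4.1) * (1 - 0.05184) := by gcongr
      _ = Y ^ (1 - β) * (1 - 0.05184) * (Real.log Y ^ 2 / 2 + 4.1) := by ring
      _ ≤ 1 * (Real.log Y ^ 2 / 2 + 4.1) := by gcongr
      _ = _ := one_mul _
  have hx : 5.5 ≤ Real.log Y := by linarith
  have hq2 : Real.log q = 2 * (Real.log Y + Real.log 2) := by linarith
  rw [hq2]
  -- With `x = log Y ≥ 5.5`, the gain from `log q = 2 (x + log 2)` outweighs the constant `4.1` and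
  -- both factors `1 - 0.05184`.
  nlinarith

end DirichletCharacter

end

theorem theorem1 (q : ℕ) [NeZero q] (χ : DirichletCharacter ℂ q)
    (hprim : χ.IsPrimitive) (hreal : MulChar.IsQuadratic χ)
    (β₀ : ℝ) (hβ₀ : IsExceptionalZero χ β₀)
    (σ : ℝ) (hσ : σ ∈ Set.Ioo β₀ 1) :
    (χ.Odd → 4 * 10 ^ 5 < q →
        1 - 800 / (Real.sqrt (q : ℝ) * Real.log (q : ℝ) ^ 2) ≤ β₀ →
        ‖deriv (DirichletCharacter.LFunction χ) (σ : ℂ)‖ ≤ 0.18 * Real.log (q : ℝ) ^ 2) ∧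
    (χ.Even → 4 * 10 ^ 5 < q →
        1 - 515 / (Real.sqrt (q : ℝ) * Real.log (q : ℝ) ^ 2) ≤ β₀ →
        ‖deriv (DirichletCharacter.LFunction χ) (σ : ℂ)‖ ≤ 0.1536 * Real.log (q : ℝ) ^ 2) ∧
    (χ.Even → 10 ^ 7 < q →
        1 - 80 / (Real.sqrt (q : ℝ) * Real.log (q : ℝ) ^ 2) ≤ β₀ →
        ‖deriv (DirichletCharacter.LFunction χ) (σ : ℂ)‖ ≤ 0.15 * Real.log (q : ℝ) ^ 2) := by
  have bound (hq : 4 * 10 ^ 5 < q) :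
      ‖deriv (DirichletCharacter.LFunction χ) (σ : ℂ)‖ ≤ 0.15 * Real.log (q : ℝ) ^ 2 :=
    DirichletCharacter.norm_deriv_LFunction_le_of_isExceptionalZero hprim hβ₀ hq hσ
  have weaken {c : ℝ} (hc : 0.15 ≤ c) (hq : 4 * 10 ^ 5 < q) :
      ‖deriv (DirichletCharacter.LFunction χ) (σ : ℂ)‖ ≤ c * Real.log (q : ℝ) ^ 2 :=
    (bound hq).trans (by gcongr)
  exact ⟨fun _ hq _ ↦ weaken (by norm_num) hq, fun _ hq _ ↦ weaken (by norm_num) hq,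
    fun _ hq _ ↦ bound (by omega)⟩
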